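/- Let the (mixed) Euler numbers $E_n$ ($n\ge 0$) be defined by $\tan(x)+\sec(x)=\sum_{n\ge 0}E_n\,\frac{x^n}{n!}$, and let $H_n=\det(E_{i+j})_{0\le i,j\le n-1}$ for $n\ge 1$, $H_0=1$, be the Hankel determinants of the sequence $(E_0,E_1,E_2,\ldots)$. Then $H_0=1$ and, for every integer $k\ge 0$, \begin{align*} H_{4k+1} &= (-1)^{k}\,\frac{((2k)!)^2}{2^{4k(2k-1)}}\prod_{j=1}^{2k-1}((2j+1)!)^4,\\ H_{4k+2} &= 0,\\ H_{4k+3} &= (-1)^{k+1}\,\frac{((2k+1)!)^2}{2^{4k(2k+1)}}\prod_{j=1}^{2k}((2j+1)!)^4,\\ H_{4k+4} &= (-1)^{k+1}\,\frac{((2k+1)!)^2\,((4k+3)!)^2}{2^{2(2k+1)^2}}\prod_{j=1}^{2k}((2j+1)!)^4, \end{align*} where empty products are equal to $1$. -/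

import Mathlib

open scoped Nat

/-- The exponential generating function `tan x + sec x` of the Euler numbers, as a formal power
series over `ℚ`: `tan x = sin x / cos x` and `sec x = 1 / cos x`. The inverse is the genuine one,
since `cos` has constant coefficient `1`. -/
noncomputable def tanAddSec : PowerSeries ℚ :=
  PowerSeries.sin ℚ * (PowerSeries.cos ℚ)⁻¹ + (PowerSeries.cos ℚ)⁻¹

/-- The (mixed) Euler numbers `E n`, defined by `tan x + sec x = ∑ E n * x ^ n / n!`. -/
noncomputable def eulerNumber (n : ℕ) : ℚ :=
  (n ! : ℚ) * PowerSeries.coeff n tanAddSec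

/-- The Hankel determinant of order `n` of the sequence `c`, namely `det (c (i + j))` with
`0 ≤ i, j ≤ n - 1`. For `n = 0` it is the determinant of the empty matrix, which is `1`. -/
def hankelDet {R : Type*} [CommRing R] (c : ℕ → R) (n : ℕ) : R :=
  Matrix.det (Matrix.of fun i j : Fin n => c ((i : ℕ) + (j : ℕ)))

/-!
Let `f = tan + sec`, so that `eulerNumber n` is the constant coefficient of `D ^ n f` with
`D = d/dx`. Some Hankel determinants of `eulerNumber` vanish, so it has no full system of orthogonal
polynomials, but the shifted sequence `eulerNumber (n + 1)`, with generating function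
`f'`, has one: the Meixner–Pollaczek polynomials
`P (n + 1) = (X - (n + 1)) * P n - n (n + 1) / 2 * P (n - 1)`.
Indeed the Riccati equation `2 f' = 1 + f ^ 2` gives `P n (D) f' = c n * f' * (f - 1) ^ n` with an
explicit constant `c n` (`aeval_orthoPoly_diffOp`), and since `f - 1` vanishes at `0`, the `P n` are
orthogonal for `eulerNumber (n + 1)`, with squared norms `h n = n! (n + 1)! / 2 ^ n` (`constantCoeff_aeval_orthoPoly`).

In the monic basis `1, X * P 0, X * P 1, …` the Hankel form of `eulerNumber` itself is therefore
tridiagonal, with off-diagonal entries `h m`, diagonal entries `(m + 1) * h m`, and a corner `1`.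
Expanding its determinant gives
`H (m + 2) = h m * ((m + 1) * H (m + 1) - h m * H m)` (`hankelDet_eulerNumber_add_two`),
and the closed formulas follow from `H 0 = H 1 = 1` by induction over blocks of four indices.
-/

/-! ### The power series `tan + sec` -/

open PowerSeries in
theorem derivative_sin_eq_cos : d⁄dX ℚ (PowerSeries.sin ℚ) = PowerSeries.cos ℚ := by
  ext n
  rw [coeff_derivative, PowerSeries.sin, PowerSeries.cos, coeff_mk, coeff_mk]
  rcases Nat.even_or_odd n with h | h
  · rw [if_neg (by simpa [Nat.even_add_one] using h), if_pos h, Nat.factorial_succ]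
    obtain ⟨m, rfl⟩ := h
    rw [show (m + m + 1) / 2 = m by omega, show (m + m) / 2 = m by omega]
    push_cast
    field_simp
  · rw [if_pos (by simpa [Nat.even_add_one] using h), if_neg (by simpa using h)]
    simp

open PowerSeries in
theorem derivative_cos_eq_neg_sin : d⁄dX ℚ (PowerSeries.cos ℚ) = -PowerSeries.sin ℚ := by
  ext n
  rw [coeff_derivative, map_neg, PowerSeries.sin, PowerSeries.cos, coeff_mk, coeff_mk]
  rcases Nat.even_or_odd n with h | h
  · rw [if_neg (by simpa [Nat.even_add_one] using h), if_pos h]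
    simp
  · rw [if_pos (by simpa [Nat.even_add_one] using h), if_neg (by simpa using h),
      Nat.factorial_succ]
    obtain ⟨m, rfl⟩ := h
    rw [show (2 * m + 1 + 1) / 2 = m + 1 by omega, show (2 * m + 1) / 2 = m by omega]
    push_cast
    simp
    field_simp
    ring

open PowerSeries in
theorem constantCoeff_sin_eq_zero : constantCoeff (PowerSeries.sin ℚ) = 0 := by
  rw [← coeff_zero_eq_constantCoeff_apply, PowerSeries.sin, coeff_mk, if_pos Even.zero]

open PowerSeries in
theorem constantCoeff_cos_eq_one : constantCoeff (PowerSeries.cos ℚ) = 1 := by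
  rw [← coeff_zero_eq_constantCoeff_apply, PowerSeries.cos, coeff_mk, if_pos Even.zero]
  simp

open PowerSeries in
theorem sin_sq_add_cos_sq_eq_one : PowerSeries.sin ℚ ^ 2 + PowerSeries.cos ℚ ^ 2 = 1 := by
  refine derivative.ext (R := ℚ) ?_ ?_
  · rw [map_add, derivative_pow, derivative_pow, derivative_sin_eq_cos, derivative_cos_eq_neg_sin,
      derivative_one]
    ring
  · simp [constantCoeff_sin_eq_zero, constantCoeff_cos_eq_one]

open PowerSeries in
theorem cos_mul_tanAddSec : PowerSeries.cos ℚ * tanAddSec = PowerSeries.sin ℚ + 1 := by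
  have h := PowerSeries.mul_inv_cancel (PowerSeries.cos ℚ) (by simp [constantCoeff_cos_eq_one])
  rw [tanAddSec]
  linear_combination (PowerSeries.sin ℚ + 1) * h

open PowerSeries in
theorem constantCoeff_tanAddSec : constantCoeff tanAddSec = 1 := by
  have h := congrArg constantCoeff cos_mul_tanAddSec
  rw [map_mul, constantCoeff_cos_eq_one, one_mul] at h
  rw [h, map_add, constantCoeff_sin_eq_zero, map_one, zero_add]

open PowerSeries in
/-- The Riccati equation `2 f' = 1 + f ^ 2` of `f = tan + sec`. -/
theorem two_mul_derivative_tanAddSec : 2 * d⁄dX ℚ tanAddSec = 1 + tanAddSec ^ 2 := by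
  have hc : PowerSeries.cos ℚ ≠ 0 := fun h => by
    simpa [h] using constantCoeff_cos_eq_one
  have h := cos_mul_tanAddSec
  have h' := congrArg (d⁄dX ℚ) h
  simp only [map_add, Derivation.leibniz, derivative_sin_eq_cos, derivative_cos_eq_neg_sin,
    derivative_one, smul_eq_mul, add_zero] at h'
  have hsc := sin_sq_add_cos_sq_eq_one
  refine mul_left_cancel₀ (pow_ne_zero 2 hc) ?_
  linear_combination 2 * PowerSeries.cos ℚ * h' -
    (PowerSeries.cos ℚ * tanAddSec + 1 - PowerSeries.sin ℚ) * h + hsc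

/-! ### Determinants -/

/-- Laplace expansion of a tridiagonal determinant along its last row and column. -/
theorem det_tridiagonal {R : Type*} [CommRing R] (T : ℕ → ℕ → R)
    (hu : ∀ i j, i + 1 < j → T i j = 0) (hl : ∀ i j, j + 1 < i → T i j = 0) (n : ℕ) :
    (Matrix.of fun i j : Fin (n + 2) => T i j).det =
      T (n + 1) (n + 1) * (Matrix.of fun i j : Fin (n + 1) => T i j).det -
        T (n + 1) n * T n (n + 1) * (Matrix.of fun i j : Fin n => T i j).det := by
  have hminor : (Matrix.of fun i j : Fin (n + 1) =>
      T i (if (j : ℕ) < n then j else j + 1)).det =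
        T n (n + 1) * (Matrix.of fun i j : Fin n => T i j).det := by
    rw [Matrix.det_succ_column _ (Fin.last n), Fin.sum_univ_castSucc, Finset.sum_eq_zero]
    · simp [Matrix.submatrix, ← two_mul]
    · intro i _
      simp [hu _ (n + 1) (Nat.succ_lt_succ i.2)]
  rw [Matrix.det_succ_row _ (Fin.last (n + 1)), Fin.sum_univ_castSucc, Fin.sum_univ_castSucc,
    Finset.sum_eq_zero]
  · have h1 : (Matrix.of fun i j : Fin (n + 2) => T i j).submatrix (Fin.last (n + 1)).succAbove
        (Fin.last n).castSucc.succAbove = Matrix.of fun i j : Fin (n + 1) =>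
      T i (if (j : ℕ) < n then j else j + 1) := by
      ext i j
      rcases lt_or_ge (j : ℕ) n with h | h
      · simp [Fin.succAbove, Fin.lt_def, h]
      · simp [Fin.succAbove, Fin.lt_def, h.not_gt]
    have h2 : (Matrix.of fun i j : Fin (n + 2) => T i j).submatrix (Fin.last (n + 1)).succAbove
        (Fin.last (n + 1)).succAbove = Matrix.of fun i j : Fin (n + 1) => T i j := by
      ext i j
      simp
    rw [h1, h2, hminor]
    simp [pow_succ, pow_add, ← mul_pow]
    ring
  · intro j _
    simp [hl (n + 1) j (Nat.succ_lt_succ j.2)]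

open Polynomial in
/-- Congruence by a unitriangular matrix: the Hankel determinant of the moments of a functional `L`
is the Gram determinant of any system of monic polynomials `Q i` of degree `i`. -/
theorem hankelDet_eq_det_gram {R : Type*} [CommRing R] (L : R[X] →ₗ[R] R) (Q : ℕ → R[X])
    (hdeg : ∀ i, (Q i).natDegree = i) (hmonic : ∀ i, (Q i).Monic) (n : ℕ) :
    hankelDet (fun m => L (X ^ m)) n = (Matrix.of fun i j : Fin n => L (Q i * Q j)).det := by
  set A : Matrix (Fin n) (Fin n) R := Matrix.of fun i j => (Q j).coeff i with hA
  have hdet : A.det = 1 :=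
    Matrix.det_matrixOfPolynomials (fun i : Fin n => Q i) (fun i => hdeg i) fun i => hmonic i
  have hsum (j : Fin n) : Q j = ∑ k : Fin n, C ((Q j).coeff k) * X ^ (k : ℕ) := by
    conv_lhs => rw [(Q j).as_sum_range_C_mul_X_pow' (n := n) (by rw [hdeg]; exact j.2)]
    exact (Fin.sum_univ_eq_sum_range (fun k => C ((Q j).coeff k) * X ^ k) n).symm
  have hmul : (Matrix.of fun i j : Fin n => L (Q i * Q j)) =
      A.transpose * (Matrix.of fun i j : Fin n => L (X ^ ((i : ℕ) + j))) * A := by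
    ext i j
    rw [Matrix.of_apply, hsum i, hsum j, Finset.sum_mul_sum, Finset.sum_comm, map_sum,
      Matrix.mul_apply]
    refine Finset.sum_congr rfl fun l _ => ?_
    rw [map_sum, Matrix.mul_apply, Finset.sum_mul]
    refine Finset.sum_congr rfl fun k _ => ?_
    rw [show C ((Q i).coeff k) * X ^ (k : ℕ) * (C ((Q j).coeff l) * X ^ (l : ℕ)) =
      ((Q i).coeff k * (Q j).coeff l) • X ^ ((k : ℕ) + l) by
        rw [smul_eq_C_mul, C_mul]; ring, map_smul]
    simp [hA]
    ring
  rw [hmul, Matrix.det_mul, Matrix.det_mul, Matrix.det_transpose, hdet, one_mul, mul_one]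
  rfl

/-! ### The moment functional and the orthogonal polynomials -/

/-- The differentiation operator on `ℚ⟦X⟧`, through which polynomials act on power series. -/
noncomputable def diffOp : Module.End ℚ (PowerSeries ℚ) :=
  (PowerSeries.derivative ℚ).toLinearMap

open Polynomial in
/-- The moment functional of the Euler numbers: `p` is sent to the constant coefficient of
`p(d/dx) (tan x + sec x)`, so that `X ^ n` is sent to `eulerNumber n`. -/
noncomputable def eulerFunctional : ℚ[X] →ₗ[ℚ] ℚ :=
  PowerSeries.coeff 0 ∘ₗ LinearMap.applyₗ tanAddSec ∘ₗ (aeval diffOp).toLinearMap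

open Polynomial in
theorem eulerFunctional_apply (p : ℚ[X]) :
    eulerFunctional p = PowerSeries.constantCoeff (aeval diffOp p tanAddSec) :=
  PowerSeries.coeff_zero_eq_constantCoeff_apply _

open Polynomial in
theorem eulerFunctional_X_pow (n : ℕ) : eulerFunctional (X ^ n) = eulerNumber n := by
  rw [eulerFunctional_apply, map_pow, aeval_X, Module.End.pow_apply]
  exact PowerSeries.constantCoeff_iterate_derivative tanAddSec n

/-- The off-diagonal coefficients `n (n + 1) / 2` of the three-term recurrence. -/
def recCoeff (n : ℕ) : ℚ := n * (n + 1) / 2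

open Polynomial in
/-- The monic Meixner–Pollaczek polynomials orthogonal for the shifted Euler numbers
`eulerNumber (n + 1)`, given by their three-term recurrence. -/
noncomputable def orthoPoly : ℕ → ℚ[X]
  | 0 => 1
  | 1 => X - 1
  | n + 2 => (X - C ((n : ℚ) + 2)) * orthoPoly (n + 1) - C (recCoeff (n + 1)) * orthoPoly n

open Polynomial in
/-- The recurrence holds from `n = 0` on, the truncated index `0 - 1` being harmless because
`recCoeff 0 = 0`. -/
theorem orthoPoly_succ (n : ℕ) : orthoPoly (n + 1) =
    (X - C ((n : ℚ) + 1)) * orthoPoly n - C (recCoeff n) * orthoPoly (n - 1) := by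
  cases n with
  | zero => simp [orthoPoly, recCoeff]
  | succ n =>
    rw [orthoPoly]
    push_cast
    rw [add_assoc, one_add_one_eq_two]

open Polynomial in
theorem orthoPoly_monic_natDegree (n : ℕ) :
    (orthoPoly n).Monic ∧ (orthoPoly n).natDegree = n := by
  induction n using Nat.strong_induction_on with
  | _ n ih =>
    match n with
    | 0 => simp [orthoPoly]
    | 1 =>
      have h := monic_X_sub_C (1 : ℚ)
      have h' := natDegree_X_sub_C (1 : ℚ)
      rw [C_1] at h h'
      exact ⟨h, h'⟩
    | n + 2 =>
      obtain ⟨hm, hd⟩ := ih (n + 1) (by omega)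
      obtain ⟨hm', hd'⟩ := ih n (by omega)
      have hM := (monic_X_sub_C ((n : ℚ) + 2)).mul hm
      have hD : ((X - C ((n : ℚ) + 2)) * orthoPoly (n + 1)).natDegree = n + 2 := by
        rw [(monic_X_sub_C ((n : ℚ) + 2)).natDegree_mul hm, natDegree_X_sub_C, hd]
        omega
      have hlt : (C (recCoeff (n + 1)) * orthoPoly n).natDegree <
          ((X - C ((n : ℚ) + 2)) * orthoPoly (n + 1)).natDegree := by
        have := natDegree_C_mul_le (recCoeff (n + 1)) (orthoPoly n)
        omega
      rw [orthoPoly]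
      exact ⟨hM.sub_of_left (degree_lt_degree hlt),
        by rw [natDegree_sub_eq_left_of_natDegree_lt hlt, hD]⟩

/-! ### The action of the orthogonal polynomials on `tan + sec` -/

/-- The series `(j + 1)! / 2 ^ j * f' * (f - 1) ^ j` with `f = tan + sec`. It is the image of `f'`
under the `j`-th orthogonal polynomial in `d/dx`, and it vanishes at `0` to order `j`. -/
noncomputable def riordanSeries (j : ℕ) : PowerSeries ℚ :=
  (((j + 1)! : ℚ) / 2 ^ j) • (diffOp tanAddSec * (tanAddSec - 1) ^ j)

theorem diffOp_mul (a b : PowerSeries ℚ) : diffOp (a * b) = a * diffOp b + b * diffOp a :=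
  (PowerSeries.derivative ℚ).leibniz a b

/-- The Riccati equation of `f` turned into a three-term relation for `f' * (f - 1) ^ j`. -/
theorem diffOp_riordanSeries (j : ℕ) : diffOp (riordanSeries j) =
    riordanSeries (j + 1) + ((j : ℚ) + 1) • riordanSeries j +
      recCoeff j • riordanSeries (j - 1) := by
  set u := tanAddSec - 1 with hu
  set g := diffOp tanAddSec with hg
  have hric : 2 * g = 2 + 2 * u + u ^ 2 := by
    have h : 2 * g = 1 + tanAddSec ^ 2 := two_mul_derivative_tanAddSec
    rw [h, hu]
    ring
  have hDu : diffOp u = g := by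
    rw [hu, map_sub, sub_eq_self]
    exact PowerSeries.derivative_one
  have half (v w : PowerSeries ℚ) (h : 2 * v = w) : v = (1 / 2 : ℚ) • w := by
    rw [← h, two_mul, ← two_smul ℚ, smul_smul]
    norm_num
  have hDg : diffOp g = g * (1 + u) := by
    have h := congrArg diffOp (half _ _ hric)
    rw [h, map_smul]
    refine (half _ _ ?_).symm
    have h2 : diffOp (2 : PowerSeries ℚ) = 0 := (PowerSeries.derivative ℚ).map_natCast 2
    rw [pow_two, map_add, map_add, diffOp_mul, diffOp_mul, h2, hDu]
    ring
  -- The products `g * (g * u ^ i)` are rewritten through `g = 1 + u + u ^ 2 / 2`.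
  have hgg (i : ℕ) : g * (g * u ^ i) =
      g * u ^ i + g * u ^ (i + 1) + (1 / 2 : ℚ) • (g * u ^ (i + 2)) := by
    have h : g * (g * u ^ i) - (g * u ^ i + g * u ^ (i + 1)) = (1 / 2 : ℚ) • (g * u ^ (i + 2)) :=
      half _ _ (by linear_combination (g * u ^ i) * hric)
    rw [← h]
    ring
  cases j with
  | zero =>
    simp only [riordanSeries, map_smul, diffOp_mul, hDg, ← hg, ← hu]
    have h1 : diffOp (1 : PowerSeries ℚ) = 0 := PowerSeries.derivative_one
    simp [recCoeff, h1]
    ring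
  | succ i =>
    have hDpow : diffOp (u ^ (i + 1)) = ((i : ℚ) + 1) • (g * u ^ i) := by
      have h : diffOp (u ^ (i + 1)) = _ := PowerSeries.derivative_pow u (i + 1)
      rw [h]
      change ((i + 1 : ℕ) : PowerSeries ℚ) * u ^ (i + 1 - 1) * diffOp u = _
      rw [hDu, PowerSeries.smul_eq_C_mul]
      push_cast
      simp only [map_add, map_natCast, map_one]
      ring
    have hD : diffOp (g * u ^ (i + 1)) = ((i : ℚ) + 1) • (g * u ^ i) +
        ((i : ℚ) + 2) • (g * u ^ (i + 1)) + (((i : ℚ) + 3) / 2) • (g * u ^ (i + 2)) := by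
      have h : u ^ (i + 1) * (g * (1 + u)) = g * u ^ (i + 1) + g * u ^ (i + 2) := by ring
      rw [diffOp_mul, hDpow, mul_smul_comm, hgg, hDg, h]
      module
    simp only [riordanSeries, map_smul, ← hg, ← hu, hD, Nat.add_sub_cancel, recCoeff, smul_add,
      smul_smul, Nat.factorial_succ (i + 1 + 1), Nat.factorial_succ (i + 1)]
    match_scalars <;> field_simp <;> ring

open Polynomial in
theorem aeval_orthoPoly_diffOp (n : ℕ) :
    aeval diffOp (orthoPoly n) (diffOp tanAddSec) = riordanSeries n := by
  induction n using Nat.strong_induction_on with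
  | _ n ih =>
    cases n with
    | zero => simp [orthoPoly, riordanSeries]
    | succ n =>
      rw [orthoPoly_succ]
      simp only [map_sub, map_mul, aeval_X, aeval_C, LinearMap.sub_apply, Module.End.mul_apply,
        Module.algebraMap_end_apply, ih n (by omega), ih (n - 1) (by omega), diffOp_riordanSeries]
      abel

/-- The squared norms `n! (n + 1)! / 2 ^ n` of the orthogonal polynomials. -/
def sqNorm (n : ℕ) : ℚ := n ! * (n + 1)! / 2 ^ n

theorem sqNorm_succ (n : ℕ) : sqNorm (n + 1) = recCoeff (n + 1) * sqNorm n := by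
  rw [sqNorm, sqNorm, recCoeff, Nat.factorial_succ (n + 1), Nat.factorial_succ n]
  push_cast
  field_simp
  ring

theorem constantCoeff_riordanSeries (j : ℕ) :
    PowerSeries.constantCoeff (riordanSeries j) = if j = 0 then 1 else 0 := by
  have h := congrArg PowerSeries.constantCoeff two_mul_derivative_tanAddSec
  have h2 : PowerSeries.constantCoeff (2 : PowerSeries ℚ) = 2 := map_ofNat _ 2
  rw [map_mul, map_add, map_pow, constantCoeff_tanAddSec, h2, map_one] at h
  have h1 : PowerSeries.constantCoeff (diffOp tanAddSec) = 1 := by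
    change PowerSeries.constantCoeff (PowerSeries.derivative ℚ tanAddSec) = 1
    linarith
  rw [riordanSeries, PowerSeries.constantCoeff_smul]
  rcases eq_or_ne j 0 with rfl | hj
  · simp [h1]
  · simp [hj, constantCoeff_tanAddSec]

open Polynomial in
theorem aeval_diffOp_orthoPoly_succ (n : ℕ) (v : PowerSeries ℚ) :
    aeval diffOp (orthoPoly (n + 1)) v = aeval diffOp (orthoPoly n) (diffOp v) -
      ((n : ℚ) + 1) • aeval diffOp (orthoPoly n) v -
        recCoeff n • aeval diffOp (orthoPoly (n - 1)) v := by
  rw [orthoPoly_succ, sub_mul, ← smul_eq_C_mul, ← smul_eq_C_mul, mul_comm X]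
  simp only [map_sub, map_mul, map_smul, aeval_X, LinearMap.sub_apply, Module.End.mul_apply,
    LinearMap.smul_apply]

open Polynomial in
/-- Orthogonality: the left-hand side is the value of the shifted functional at
`orthoPoly i * orthoPoly j`. -/
theorem constantCoeff_aeval_orthoPoly (i j : ℕ) :
    PowerSeries.constantCoeff (aeval diffOp (orthoPoly i) (riordanSeries j)) =
      if i = j then sqNorm i else 0 := by
  induction i using Nat.strong_induction_on generalizing j with
  | _ i ih =>
    cases i with
    | zero => simp [orthoPoly, constantCoeff_riordanSeries, sqNorm, eq_comm]
    | succ i =>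
      simp only [aeval_diffOp_orthoPoly_succ, diffOp_riordanSeries, map_add, map_sub, map_smul,
        PowerSeries.constantCoeff_smul, ih i (by omega), ih (i - 1) (by omega), smul_eq_mul]
      have hrec : recCoeff 0 = 0 := by simp [recCoeff]
      rcases eq_or_ne j (i + 1) with rfl | h1
      · have h2 : i - 1 ≠ i + 1 := by omega
        have h3 : i ≠ i + 1 + 1 := by omega
        simp [h2, h3, sqNorm_succ]
      rcases eq_or_ne j i with rfl | h2
      · rcases j with - | j
        · simp [hrec]
        · simp
      rcases eq_or_ne i (j + 1) with rfl | h3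
      · have h4 : j + 1 ≠ j - 1 := by omega
        have h5 : j + 1 + 1 ≠ j := by omega
        simp [h4, h5, sqNorm_succ]
      · have h4 : i = j - 1 → j = 0 := by omega
        have h5 : i - 1 = j → i = 0 := by omega
        simp only [h3, h1.symm, h2.symm, if_false]
        split_ifs with h6 h7 h7 <;> simp_all

/-! ### The tridiagonal Gram matrix -/

open Polynomial in
/-- The monic basis `1, X * P 0, X * P 1, …` in which the Gram matrix of `eulerFunctional` is
tridiagonal, `P` being the orthogonal polynomials of the shifted Euler numbers. -/
noncomputable def gramBasis : ℕ → ℚ[X]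
  | 0 => 1
  | i + 1 => X * orthoPoly i

open Polynomial in
theorem gramBasis_monic_natDegree (i : ℕ) :
    (gramBasis i).Monic ∧ (gramBasis i).natDegree = i := by
  cases i with
  | zero => simp [gramBasis]
  | succ i =>
    obtain ⟨hm, hd⟩ := orthoPoly_monic_natDegree i
    exact ⟨monic_X.mul hm, by rw [gramBasis, monic_X.natDegree_mul hm, natDegree_X, hd, add_comm]⟩

open Polynomial in
theorem eulerFunctional_gramBasis_succ_succ (i j : ℕ) :
    eulerFunctional (gramBasis (i + 1) * gramBasis (j + 1)) =
      (if i = j + 1 then sqNorm i else 0) + ((j : ℚ) + 1) * (if i = j then sqNorm i else 0) +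
        recCoeff j * (if i = j - 1 then sqNorm i else 0) := by
  rw [eulerFunctional_apply, gramBasis, gramBasis,
    show X * orthoPoly i * (X * orthoPoly j) = orthoPoly i * (X * (orthoPoly j * X)) by ring]
  simp only [map_mul, aeval_X, Module.End.mul_apply, aeval_orthoPoly_diffOp, diffOp_riordanSeries,
    map_add, map_smul, PowerSeries.constantCoeff_smul, constantCoeff_aeval_orthoPoly, smul_eq_mul]

open Polynomial in
theorem eulerFunctional_gramBasis_zero_succ (j : ℕ) :
    eulerFunctional (gramBasis 0 * gramBasis (j + 1)) = if j = 0 then 1 else 0 := by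
  rw [eulerFunctional_apply, gramBasis, gramBasis, one_mul, mul_comm]
  simp only [map_mul, aeval_X, Module.End.mul_apply, aeval_orthoPoly_diffOp,
    constantCoeff_riordanSeries]

theorem eulerFunctional_gramBasis_of_lt {i j : ℕ} (h : i + 1 < j) :
    eulerFunctional (gramBasis i * gramBasis j) = 0 := by
  obtain ⟨j, rfl⟩ : ∃ k, j = k + 1 := ⟨j - 1, by omega⟩
  cases i with
  | zero => rw [eulerFunctional_gramBasis_zero_succ, if_neg (by omega)]
  | succ i =>
    rw [eulerFunctional_gramBasis_succ_succ, if_neg (by omega), if_neg (by omega),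
      if_neg (by omega)]
    ring

theorem eulerFunctional_gramBasis_diag (m : ℕ) :
    eulerFunctional (gramBasis (m + 1) * gramBasis (m + 1)) = ((m : ℚ) + 1) * sqNorm m := by
  rw [eulerFunctional_gramBasis_succ_succ, if_neg (by omega), if_pos rfl]
  cases m with
  | zero => simp [recCoeff]
  | succ m => simp

theorem eulerFunctional_gramBasis_offDiag (m : ℕ) :
    eulerFunctional (gramBasis m * gramBasis (m + 1)) = sqNorm m := by
  cases m with
  | zero => simp [eulerFunctional_gramBasis_zero_succ, sqNorm]
  | succ m =>
    rw [eulerFunctional_gramBasis_succ_succ, if_neg (by omega), if_neg (by omega),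
      if_pos (by omega), sqNorm_succ]
    ring

theorem hankelDet_eulerNumber_zero : hankelDet eulerNumber 0 = 1 :=
  Matrix.det_fin_zero

theorem hankelDet_eulerNumber_one : hankelDet eulerNumber 1 = 1 := by
  rw [hankelDet, Matrix.det_fin_one]
  simp [eulerNumber, constantCoeff_tanAddSec]

/-- The continuant recurrence of the tridiagonal Gram matrices. -/
theorem hankelDet_eulerNumber_add_two (m : ℕ) : hankelDet eulerNumber (m + 2) =
    sqNorm m * (((m : ℚ) + 1) * hankelDet eulerNumber (m + 1) -
      sqNorm m * hankelDet eulerNumber m) := by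
  have hgram (n : ℕ) : hankelDet eulerNumber n = (Matrix.of fun i j : Fin n =>
      eulerFunctional (gramBasis i * gramBasis j)).det := by
    rw [← hankelDet_eq_det_gram eulerFunctional gramBasis
      (fun i => (gramBasis_monic_natDegree i).2) (fun i => (gramBasis_monic_natDegree i).1)]
    exact congrArg (hankelDet · n) (funext fun m => (eulerFunctional_X_pow m).symm)
  rw [hgram, hgram, hgram,
    det_tridiagonal (fun i j => eulerFunctional (gramBasis i * gramBasis j))
      (fun i j h => eulerFunctional_gramBasis_of_lt h)
      (fun i j h => by rw [mul_comm]; exact eulerFunctional_gramBasis_of_lt h),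
    eulerFunctional_gramBasis_diag, eulerFunctional_gramBasis_offDiag, mul_comm (gramBasis (m + 1)),
    eulerFunctional_gramBasis_offDiag]
  ring

/-! ### Closed formulas -/

/-- The product of the closed formulas, with its range extended by the trivial factor `j = 0`. -/
def oddFactorialProd (n : ℕ) : ℚ := ∏ j ∈ Finset.range n, ((2 * j + 1)! : ℚ) ^ 4

theorem prod_Icc_eq_oddFactorialProd (n : ℕ) :
    ∏ j ∈ Finset.Icc 1 n, ((2 * j + 1)! : ℚ) ^ 4 = oddFactorialProd (n + 1) := by
  rw [oddFactorialProd, Finset.prod_range_succ', Finset.range_eq_Ico, Finset.prod_Ico_add'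
    (fun j => ((2 * j + 1)! : ℚ) ^ 4)]
  simp
  rfl

/-- One step of the recurrence past a vanishing determinant. -/
theorem hankelDet_eulerNumber_add_two_of_zero {m : ℕ} (h : hankelDet eulerNumber (m + 1) = 0) :
    hankelDet eulerNumber (m + 2) = -sqNorm m ^ 2 * hankelDet eulerNumber m := by
  rw [hankelDet_eulerNumber_add_two, h]
  ring

theorem hankelDet_eulerNumber_four_mul_add_three (k : ℕ)
    (h1 : hankelDet eulerNumber (4 * k + 1) =
      (-1) ^ k * ((2 * k)! ^ 2 / 2 ^ (8 * k ^ 2) * 2 ^ (4 * k)) * oddFactorialProd (2 * k))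
    (h2 : hankelDet eulerNumber (4 * k + 2) = 0) :
    hankelDet eulerNumber (4 * k + 3) =
        (-1 : ℚ) ^ (k + 1) * (((2 * k + 1)! : ℚ) ^ 2 / 2 ^ (4 * k * (2 * k + 1))) *
          oddFactorialProd (2 * k + 1) := by
  rw [hankelDet_eulerNumber_add_two_of_zero h2, h1, oddFactorialProd, oddFactorialProd,
    Finset.prod_range_succ, sqNorm, show 2 * (2 * k) + 1 = 4 * k + 1 by ring,
    Nat.factorial_succ (4 * k + 1), Nat.factorial_succ (2 * k),
    show 4 * k * (2 * k + 1) = 8 * k ^ 2 + 4 * k by ring]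
  push_cast
  field_simp
  ring

theorem hankelDet_eulerNumber_four_mul_add_four (k : ℕ)
    (h3 : hankelDet eulerNumber (4 * k + 3) =
        (-1 : ℚ) ^ (k + 1) * (((2 * k + 1)! : ℚ) ^ 2 / 2 ^ (4 * k * (2 * k + 1))) *
          oddFactorialProd (2 * k + 1))
    (h2 : hankelDet eulerNumber (4 * k + 2) = 0) :
    hankelDet eulerNumber (4 * k + 4) =
        (-1 : ℚ) ^ (k + 1) *
          (((2 * k + 1)! : ℚ) ^ 2 * ((4 * k + 3)! : ℚ) ^ 2 / 2 ^ (2 * (2 * k + 1) ^ 2)) *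
          oddFactorialProd (2 * k + 1) := by
  rw [hankelDet_eulerNumber_add_two, h2, h3, sqNorm,
    Nat.factorial_succ (4 * k + 2),
    show 4 * k * (2 * k + 1) = 8 * k ^ 2 + 4 * k by ring,
    show 2 * (2 * k + 1) ^ 2 = 8 * k ^ 2 + 4 * k + (4 * k + 2) by ring]
  push_cast
  field_simp
  ring

/-- The two terms of the recurrence for the index `4 k + 6` cancel, so the next block starts as the
present one did. -/
theorem hankelDet_eulerNumber_four_mul_succ (k : ℕ)
    (h3 : hankelDet eulerNumber (4 * k + 3) =
        (-1 : ℚ) ^ (k + 1) * (((2 * k + 1)! : ℚ) ^ 2 / 2 ^ (4 * k * (2 * k + 1))) *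
          oddFactorialProd (2 * k + 1))
    (h4 : hankelDet eulerNumber (4 * k + 4) =
        (-1 : ℚ) ^ (k + 1) *
          (((2 * k + 1)! : ℚ) ^ 2 * ((4 * k + 3)! : ℚ) ^ 2 / 2 ^ (2 * (2 * k + 1) ^ 2)) *
          oddFactorialProd (2 * k + 1)) :
    hankelDet eulerNumber (4 * (k + 1) + 1) =
      (-1) ^ (k + 1) * ((2 * (k + 1))! ^ 2 / 2 ^ (8 * (k + 1) ^ 2) * 2 ^ (4 * (k + 1))) *
        oddFactorialProd (2 * (k + 1)) ∧
    hankelDet eulerNumber (4 * (k + 1) + 2) = 0 := by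
  have h5 : hankelDet eulerNumber (4 * (k + 1) + 1) =
      (-1) ^ (k + 1) * ((2 * (k + 1))! ^ 2 / 2 ^ (8 * (k + 1) ^ 2) * 2 ^ (4 * (k + 1))) *
        oddFactorialProd (2 * (k + 1)) := by
    rw [show 4 * (k + 1) + 1 = 4 * k + 3 + 2 by ring, hankelDet_eulerNumber_add_two, h3, h4, sqNorm,
      show 2 * (k + 1) = 2 * k + 1 + 1 by ring, oddFactorialProd, oddFactorialProd,
      Finset.prod_range_succ _ (2 * k + 1), show 2 * (2 * k + 1) + 1 = 4 * k + 3 by ring,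
      Nat.factorial_succ (2 * k + 1), Nat.factorial_succ (4 * k + 3),
      show 4 * k * (2 * k + 1) = 8 * k ^ 2 + 4 * k by ring,
      show 2 * (2 * k + 1) ^ 2 = 8 * k ^ 2 + 4 * k + (4 * k + 2) by ring,
      show 8 * (k + 1) ^ 2 = 8 * k ^ 2 + 16 * k + 8 by ring]
    push_cast
    field_simp
    ring
  refine ⟨h5, ?_⟩
  rw [show 4 * (k + 1) + 2 = 4 * k + 4 + 2 by ring, hankelDet_eulerNumber_add_two,
      show 4 * k + 4 + 1 = 4 * (k + 1) + 1 by ring, h5, h4, sqNorm,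
      show 2 * (k + 1) = 2 * k + 1 + 1 by ring, oddFactorialProd, oddFactorialProd,
      Finset.prod_range_succ _ (2 * k + 1), show 2 * (2 * k + 1) + 1 = 4 * k + 3 by ring,
      Nat.factorial_succ (2 * k + 1), Nat.factorial_succ (4 * k + 4),
      Nat.factorial_succ (4 * k + 3),
      show 2 * (2 * k + 1) ^ 2 = 8 * k ^ 2 + 4 * k + (4 * k + 2) by ring,
      show 8 * (k + 1) ^ 2 = 8 * k ^ 2 + 16 * k + 8 by ring]
  push_cast
  field_simp
  ring

/-- The exponent `4 k (2 k - 1)` of the closed formula is written as `8 k ^ 2 - 4 k`, with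
`2 ^ (4 k)` in the numerator, to avoid the truncated subtraction. -/
theorem hankelDet_eulerNumber_four_mul_add_one (k : ℕ) :
    hankelDet eulerNumber (4 * k + 1) =
      (-1) ^ k * ((2 * k)! ^ 2 / 2 ^ (8 * k ^ 2) * 2 ^ (4 * k)) * oddFactorialProd (2 * k) ∧
    hankelDet eulerNumber (4 * k + 2) = 0 := by
  induction k with
  | zero =>
    refine ⟨by simp [hankelDet_eulerNumber_one, oddFactorialProd], ?_⟩
    rw [mul_zero, hankelDet_eulerNumber_add_two, zero_add, hankelDet_eulerNumber_one,
      hankelDet_eulerNumber_zero]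
    simp [sqNorm]
  | succ k ih =>
    have h3 := hankelDet_eulerNumber_four_mul_add_three k ih.1 ih.2
    exact hankelDet_eulerNumber_four_mul_succ k h3
      (hankelDet_eulerNumber_four_mul_add_four k h3 ih.2)

theorem theorem2 :
    hankelDet eulerNumber 0 = 1 ∧
    ∀ k : ℕ,
      hankelDet eulerNumber (4 * k + 1) =
        (-1 : ℚ) ^ k * (((2 * k)! : ℚ) ^ 2 / 2 ^ (4 * k * (2 * k - 1))) *
          ∏ j ∈ Finset.Icc 1 (2 * k - 1), ((2 * j + 1)! : ℚ) ^ 4 ∧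
      hankelDet eulerNumber (4 * k + 2) = 0 ∧
      hankelDet eulerNumber (4 * k + 3) =
        (-1 : ℚ) ^ (k + 1) * (((2 * k + 1)! : ℚ) ^ 2 / 2 ^ (4 * k * (2 * k + 1))) *
          ∏ j ∈ Finset.Icc 1 (2 * k), ((2 * j + 1)! : ℚ) ^ 4 ∧
      hankelDet eulerNumber (4 * k + 4) =
        (-1 : ℚ) ^ (k + 1) *
          (((2 * k + 1)! : ℚ) ^ 2 * ((4 * k + 3)! : ℚ) ^ 2 / 2 ^ (2 * (2 * k + 1) ^ 2)) *
          ∏ j ∈ Finset.Icc 1 (2 * k), ((2 * j + 1)! : ℚ) ^ 4 := by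
  refine ⟨hankelDet_eulerNumber_zero, fun k => ?_⟩
  obtain ⟨h1, h2⟩ := hankelDet_eulerNumber_four_mul_add_one k
  have h3 := hankelDet_eulerNumber_four_mul_add_three k h1 h2
  have h4 := hankelDet_eulerNumber_four_mul_add_four k h3 h2
  rw [prod_Icc_eq_oddFactorialProd (2 * k)]
  refine ⟨?_, h2, h3, h4⟩
  -- For `k = 0` both `2 * k - 1` are truncated: the exponent is `0` and the product is empty.
  rcases k with - | k
  · simp [hankelDet_eulerNumber_one]
  · rw [h1, prod_Icc_eq_oddFactorialProd, show 2 * (k + 1) - 1 = 2 * k + 1 by omega,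
      show 8 * (k + 1) ^ 2 = 4 * (k + 1) * (2 * k + 1) + 4 * (k + 1) by ring,
      pow_add 2 (4 * (k + 1) * (2 * k + 1)), show 2 * k + 1 + 1 = 2 * (k + 1) by ring]
    field_simp
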